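/- Let $\rho,\sigma$ be density matrices on $\mathbb C^d$ and let $\ell\ge 1$. Let $E=\{E_i\}$ be the projective measurement on $(\mathbb C^d)^{\otimes\ell}$ given by the orthogonal projectors onto the $SU(d)$ blocks, where $SU(d)$ acts by $g\mapsto g^{\otimes\ell}$: the blocks are either the isotypic components (Schur–Weyl blocks), or the members of any orthogonal decomposition of $(\mathbb C^d)^{\otimes\ell}$ into irreducible subrepresentations (the result is asserted in both cases). Let $F=\{F_k\}$, $F_k=|f_k\rangle\langle f_k|$, be the measurement in any orthonormal eigenbasis $(f_k)$ of $\rho^{\otimes\ell}$ that is compatible with $E$, i.e. each $f_k$ lies in one of the blocks. Let $M_\rho=F\times E$ be the measurement that applies $E$ first and then $F$, with outcome probabilities $p(i,k)=\operatorname{Tr}(F_kE_i\rho^{\otimes\ell}E_iF_k)$ and $q(i,k)=\operatorname{Tr}(F_kE_i\sigma^{\otimes\ell}E_iF_k)$, and let $$D_{M_\rho}(\rho^{\otimes\ell}\|\sigma^{\otimes\ell})=\sum_{i,k}p(i,k)\log\frac{p(i,k)}{q(i,k)}$$ be the classical relative entropy of these outcome distributions. Let $D(\rho\|\sigma)=\operatorname{Tr}\rho(\log\rho-\log\sigma)$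 be the quantum relative entropy. Write $\varepsilon_F(A)=\sum_kF_kAF_k$, $a_i=\operatorname{Tr}E_i\rho^{\otimes\ell}E_i$, $b_i=\operatorname{Tr}E_i\sigma^{\otimes\ell}E_i$, $\rho_i=\frac1{a_i}E_i\rho^{\otimes\ell}E_i$, $\sigma_i=\frac1{b_i}E_i\sigma^{\otimes\ell}E_i$, and $$\omega(\sigma)=\sup_{i:\,a_i\neq0}\operatorname{Tr}\rho_i\bigl(\log\varepsilon_F(\sigma_i)-\log\sigma_i\bigr).$$ All these quantities take values in the extended reals: $D(\rho\|\sigma)$, its classical counterpart, and the $i$-th term of $\omega(\sigma)$ are $+\infty$ when the support of the first argument ($\rho$, $p$, $\rho_i$) is not contained in that of the second ($\sigma$, $q$, $\sigma_i$; with $\sigma_i:=0$ if $b_i=0$), and otherwise logarithms are taken on the supports. Then $$D(\rho\|\sigma)-\frac{\omega(\sigma)}{\ell}\;\le\;\frac1\ell D_{M_\rho}(\rho^{\otimes\ell}\|\sigma^{\otimes\ell})\;\le\;D(\rho\|\sigma),$$ where the first inequality is an assertion only if $D(\rho\|\sigma)<\infty$ (otherwise its left side is of the form $\infty-\infty$,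 read as $-\infty$). Moreover $$\omega(\sigma)\le\max_{i:\,a_i\neq0}\bigl(-\log\lambda_{\min}(\sigma_i)\bigr),$$ where $\lambda_{\min}(\sigma_i)$ is the least eigenvalue of $\sigma_i$ as an operator on the $i$-th block, and $-\log0=+\infty$. -/

import Mathlib

open scoped Matrix ComplexOrder

noncomputable section

/-! ### Finite-dimensional states and entropies (natural logarithm) -/

section Quantum

variable {n : Type*} [Fintype n] [DecidableEq n]

/-- A density matrix: positive semidefinite with unit trace. -/
def IsState (ρ : Matrix n n ℂ) : Prop :=
  ρ.PosSemidef ∧ ρ.trace = 1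

/-- `supp ρ ⊆ supp σ`, expressed for Hermitian matrices as `ker σ ⊆ ker ρ`. -/
def SuppLE (ρ σ : Matrix n n ℂ) : Prop :=
  ∀ v : n → ℂ, σ *ᵥ v = 0 → ρ *ᵥ v = 0

/-- The logarithm of a positive semidefinite matrix, by functional calculus. It acts as the
logarithm on the support and as zero on the kernel (`Real.log 0 = 0`). -/
def matrixLog (A : Matrix n n ℂ) : Matrix n n ℂ :=
  cfc Real.log A

open Classical in
/-- Quantum relative entropy `D(ρ‖σ) = Tr ρ (log ρ - log σ)`, which is `+∞` unless
`supp ρ ⊆ supp σ`. -/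
def relEntropy (ρ σ : Matrix n n ℂ) : EReal :=
  if SuppLE ρ σ then (((ρ * (matrixLog ρ - matrixLog σ)).trace.re : ℝ) : EReal) else ⊤

open Classical in
/-- Classical relative entropy `∑ x, p x log (p x / q x)` of two distributions on a finite set,
which is `+∞` unless `p` vanishes wherever `q` does. -/
def classicalRelEntropy {α : Type*} [Fintype α] (p q : α → ℝ) : EReal :=
  if ∀ x, q x = 0 → p x = 0 then ((∑ x, p x * Real.log (p x / q x) : ℝ) : EReal) else ⊤

/-- The matrix of the orthogonal projector onto the subspace `W`. -/
def projMatrix (W : Submodule ℂ (EuclideanSpace ℂ n)) : Matrix n n ℂ :=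
  (Matrix.toEuclideanCLM (n := n) (𝕜 := ℂ)).symm W.starProjection

/-- The rank-one matrix `|v⟩⟨v|`. -/
def ketbra (v : EuclideanSpace ℂ n) : Matrix n n ℂ :=
  Matrix.vecMulVec v.ofLp (star v.ofLp)

variable {ι κ : Type*} [Fintype κ]

/-- The operation `ε_F(A) = ∑ k, F_k A F_k` of the rank-one measurement `F_k = |f_k⟩⟨f_k|`. -/
def pinching (f : OrthonormalBasis κ ℂ (EuclideanSpace ℂ n)) (A : Matrix n n ℂ) :
    Matrix n n ℂ :=
  ∑ k, ketbra (f k) * A * ketbra (f k)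

/-- Joint outcome probabilities for the state `ρ` when the projective measurement `E` onto the
subspaces `B i` is applied first and the rank-one measurement `F_k = |f_k⟩⟨f_k|` second:
`p(i, k) = Tr (F_k E_i ρ E_i F_k)`. -/
def outcomeProb (B : ι → Submodule ℂ (EuclideanSpace ℂ n))
    (f : OrthonormalBasis κ ℂ (EuclideanSpace ℂ n)) (ρ : Matrix n n ℂ) : ι × κ → ℝ :=
  fun x => (ketbra (f x.2) * projMatrix (B x.1) * ρ * projMatrix (B x.1) *
    ketbra (f x.2)).trace.re

/-- `D_M(ρ‖σ)`: the relative entropy of the outcome distributions of the measurement `M = F × E`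
(first `E`, then `F`). -/
def measuredRelEntropy [Fintype ι] (B : ι → Submodule ℂ (EuclideanSpace ℂ n))
    (f : OrthonormalBasis κ ℂ (EuclideanSpace ℂ n)) (ρ σ : Matrix n n ℂ) : EReal :=
  classicalRelEntropy (outcomeProb B f ρ) (outcomeProb B f σ)

/-- The weight `Tr (E ρ E)` of `ρ` in the subspace `W`, with projector `E`. -/
def blockWeight (W : Submodule ℂ (EuclideanSpace ℂ n)) (ρ : Matrix n n ℂ) : ℝ :=
  (projMatrix W * ρ * projMatrix W).trace.re

/-- The normalized block `E ρ E / Tr (E ρ E)`. -/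
def blockState (W : Submodule ℂ (EuclideanSpace ℂ n)) (ρ : Matrix n n ℂ) : Matrix n n ℂ :=
  (((blockWeight W ρ)⁻¹ : ℝ) : ℂ) • (projMatrix W * ρ * projMatrix W)

open Classical in
/-- `Tr ρ (log ε_F(σ) - log σ)`, which is `+∞` unless `supp ρ ⊆ supp σ`. -/
def pinchingGap (f : OrthonormalBasis κ ℂ (EuclideanSpace ℂ n)) (ρ σ : Matrix n n ℂ) : EReal :=
  if SuppLE ρ σ then
    (((ρ * (matrixLog (pinching f σ) - matrixLog σ)).trace.re : ℝ) : EReal) else ⊤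

/-- The quantity `ω = sup_i Tr ρ_i (log ε_F(σ_i) - log σ_i)`; the supremum runs over the blocks on
which `ρ_i` is defined, that is, those with `a_i = Tr (E_i ρ E_i) ≠ 0`. -/
def omega (B : ι → Submodule ℂ (EuclideanSpace ℂ n))
    (f : OrthonormalBasis κ ℂ (EuclideanSpace ℂ n)) (ρ σ : Matrix n n ℂ) : EReal :=
  ⨆ (i : ι) (_ : blockWeight (B i) ρ ≠ 0),
    pinchingGap f (blockState (B i) ρ) (blockState (B i) σ)

/-- The least eigenvalue of `A` as an operator on the (`A`-invariant) subspace `W`. -/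
def minEigenvalueOn (W : Submodule ℂ (EuclideanSpace ℂ n)) (A : Matrix n n ℂ) : ℝ :=
  sInf {μ : ℝ | ∃ v ∈ W, v ≠ 0 ∧ Matrix.toEuclideanLin A v = (μ : ℂ) • v}

/-- `-log x` for `x ≥ 0`, with `-log 0 = +∞`. -/
def negLog (x : ℝ) : EReal :=
  -ENNReal.log (ENNReal.ofReal x)

end Quantum

/-! ### The representation of `SU(d)` on `(ℂ^d)^{⊗ℓ}` -/

/-- The space `(ℂ^d)^{⊗ℓ}`, in the product basis indexed by `Fin ℓ → Fin d`. -/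
abbrev TensorSpace (d ℓ : ℕ) : Type :=
  EuclideanSpace ℂ (Fin ℓ → Fin d)

/-- The tensor power `A^{⊗ℓ}`. -/
def tensorPow {d : ℕ} (ℓ : ℕ) (A : Matrix (Fin d) (Fin d) ℂ) :
    Matrix (Fin ℓ → Fin d) (Fin ℓ → Fin d) ℂ :=
  Matrix.of fun i j => ∏ t, A (i t) (j t)

theorem tensorPow_one (d ℓ : ℕ) : tensorPow ℓ (1 : Matrix (Fin d) (Fin d) ℂ) = 1 := by
  ext i j
  simp only [tensorPow, Matrix.of_apply, Matrix.one_apply]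
  by_cases h : i = j
  · simp [h]
  · obtain ⟨t, ht⟩ := Function.ne_iff.mp h
    rw [if_neg h]
    exact Finset.prod_eq_zero (Finset.mem_univ t) (if_neg ht)

theorem tensorPow_mul {d : ℕ} (ℓ : ℕ) (A A' : Matrix (Fin d) (Fin d) ℂ) :
    tensorPow ℓ (A * A') = tensorPow ℓ A * tensorPow ℓ A' := by
  ext i j
  simp only [tensorPow, Matrix.of_apply, Matrix.mul_apply, ← Finset.prod_mul_distrib]
  rw [Finset.prod_univ_sum, Fintype.piFinset_univ]

/-- The representation `g ↦ g^{⊗ℓ}` of `SU(d)` on `(ℂ^d)^{⊗ℓ}`. -/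
def tensorRep (d ℓ : ℕ) :
    Representation ℂ (Matrix.specialUnitaryGroup (Fin d) ℂ) (TensorSpace d ℓ) where
  toFun g := (Matrix.toEuclideanCLM (n := Fin ℓ → Fin d) (𝕜 := ℂ)
    (tensorPow ℓ (g : Matrix (Fin d) (Fin d) ℂ))).toLinearMap
  map_one' := by
    rw [OneMemClass.coe_one, tensorPow_one, map_one]
    rfl
  map_mul' g h := by
    rw [Submonoid.coe_mul, tensorPow_mul, map_mul]
    rfl

section Blocks

variable {d ℓ : ℕ} {ι κ : Type*} [Fintype κ]

/-- The `SU(d)`-invariant subspaces `B i` are pairwise orthogonal and span `(ℂ^d)^{⊗ℓ}`. -/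
def IsOrthogonalDecomposition (B : ι → Subrepresentation (tensorRep d ℓ)) : Prop :=
  (∀ i j, i ≠ j → (B i).toSubmodule ⟂ (B j).toSubmodule) ∧ (⨆ i, (B i).toSubmodule) = ⊤

/-- An orthogonal decomposition of `(ℂ^d)^{⊗ℓ}` into irreducible representations of `SU(d)`. -/
def IsIrrepDecomposition (B : ι → Subrepresentation (tensorRep d ℓ)) : Prop :=
  IsOrthogonalDecomposition B ∧ ∀ i, (B i).toRepresentation.IsIrreducible

/-- The decomposition of `(ℂ^d)^{⊗ℓ}` into its `SU(d)`-isotypic components (the Schur-Weyl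
blocks): two irreducible subrepresentations of blocks `B i`, `B j` are isomorphic exactly
when the blocks are the same. -/
def IsIsotypicDecomposition (B : ι → Subrepresentation (tensorRep d ℓ)) : Prop :=
  IsOrthogonalDecomposition B ∧ (∀ i, B i ≠ ⊥) ∧
    ∀ i j, ∀ S T : Subrepresentation (tensorRep d ℓ), S ≤ B i → T ≤ B j →
      S.toRepresentation.IsIrreducible → T.toRepresentation.IsIrreducible →
        (Nonempty (S.toRepresentation.Equiv T.toRepresentation) ↔ i = j)

/-- The orthonormal basis `f` consists of eigenvectors of `ρ^{⊗ℓ}`, and each `f k` lies in one of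
the blocks `B i`; so the measurement `F_k = |f_k⟩⟨f_k|` refines the projection `E` onto the
blocks (`E ≤ F`). -/
def IsAdaptedEigenbasis (B : ι → Subrepresentation (tensorRep d ℓ))
    (ρ : Matrix (Fin d) (Fin d) ℂ) (f : OrthonormalBasis κ ℂ (TensorSpace d ℓ)) : Prop :=
  (∀ k, ∃ c : ℂ, Matrix.toEuclideanLin (tensorPow ℓ ρ) (f k) = c • f k) ∧
    ∀ k, ∃ i, f k ∈ (B i).toSubmodule

/-- The block subspaces, as plain subspaces. -/
def blocks (B : ι → Subrepresentation (tensorRep d ℓ)) : ι → Submodule ℂ (TensorSpace d ℓ) :=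
  fun i => (B i).toSubmodule

end Blocks

end

/-! Write R = ρ^{⊗ℓ}, S = σ^{⊗ℓ}. What the argument takes from the blocks is that they are pairwise
orthogonal and `SU(d)`-invariant, which covers both kinds of decomposition at once. Invariance
extends from g^{⊗ℓ} to A^{⊗ℓ} for every Hermitian A (`tensorPow_mem_of_isHermitian`), so R and S
commute with every E_i.

Suppose supp ρ ⊆ supp σ and let R f_k = r_k f_k. Then D(R‖S) - D_M(R‖S) = ∑ r_k g_k, where g_k =
log⟨f_k, S f_k⟩ - ⟨f_k, (log S) f_k⟩ is `logGap` (`sum_logGap_eq`). Jensen's inequality gives g_k ≥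
0 whenever r_k ≠ 0; with the additivity D(R‖S) = ℓ D(ρ‖σ) this is the upper bound. For the lower
bound, normalizing a block of S shifts both logarithms in g_k by the same constant, so the part of ∑
r_k g_k in block i is a_i times the i-th term of ω (`pinchingGap_blockState`). As the a_i sum to 1,
the total is an average of these terms and is at most ω.

If the support condition fails, then D and ω are both +∞. The bound on ω holds because ⟨f_k, σ_i
f_k⟩ ≤ 1, while log σ_i ≥ log λ_min(σ_i) on the block. -/

set_option linter.unusedSectionVars false

/-! ### Functional calculus on eigenvectors, spectral weights and Jensen's inequality -/

section Spectral

variable {n : Type*} [Fintype n] [DecidableEq n]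

theorem Matrix.IsHermitian.cfc_eq_mul {A : Matrix n n ℂ} (hA : A.IsHermitian) (g : ℝ → ℝ) :
    cfc g A = (hA.eigenvectorUnitary : Matrix n n ℂ) *
      Matrix.diagonal (fun j => ((g (hA.eigenvalues j) : ℝ) : ℂ)) *
        star (hA.eigenvectorUnitary : Matrix n n ℂ) := by
  rw [hA.cfc_eq, Matrix.IsHermitian.cfc, Unitary.conjStarAlgAut_apply]
  rfl

theorem Matrix.IsHermitian.eq_mul_diagonal_mul {A : Matrix n n ℂ} (hA : A.IsHermitian) :
    A = (hA.eigenvectorUnitary : Matrix n n ℂ) *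
      Matrix.diagonal (fun j => ((hA.eigenvalues j : ℝ) : ℂ)) *
        star (hA.eigenvectorUnitary : Matrix n n ℂ) := by
  conv_lhs => rw [← cfc_id ℝ A hA.isSelfAdjoint]
  rw [hA.cfc_eq_mul]
  rfl

/-- In eigenbasis coordinates of `A`, the vector `v` has nonzero entries only where the eigenvalue
is `μ`. -/
theorem cfc_mulVec_of_eigen {A : Matrix n n ℂ} (hA : A.IsHermitian) (g : ℝ → ℝ) {μ : ℝ}
    {v : n → ℂ} (hv : A *ᵥ v = (μ : ℂ) • v) : cfc g A *ᵥ v = ((g μ : ℝ) : ℂ) • v := by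
  set U : Matrix n n ℂ := (hA.eigenvectorUnitary : Matrix n n ℂ) with hU
  have hUU : star U * U = 1 := Unitary.coe_star_mul_self hA.eigenvectorUnitary
  have hUU' : U * star U = 1 := Unitary.coe_mul_star_self hA.eigenvectorUnitary
  have h1 : Matrix.diagonal (fun j => ((hA.eigenvalues j : ℝ) : ℂ)) *ᵥ (star U *ᵥ v) =
      (μ : ℂ) • (star U *ᵥ v) := by
    rw [← Matrix.mulVec_smul, ← hv, Matrix.mulVec_mulVec, Matrix.mulVec_mulVec]
    congr 1
    conv_rhs => rw [hA.eq_mul_diagonal_mul]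
    rw [← Matrix.mul_assoc, ← Matrix.mul_assoc, hUU, Matrix.one_mul]
  have h2 : Matrix.diagonal (fun j => ((g (hA.eigenvalues j) : ℝ) : ℂ)) *ᵥ (star U *ᵥ v) =
      ((g μ : ℝ) : ℂ) • (star U *ᵥ v) := by
    ext j
    have := congrFun h1 j
    simp only [Matrix.mulVec_diagonal, Pi.smul_apply, smul_eq_mul] at this ⊢
    rcases mul_eq_mul_right_iff.mp this with h | h
    · rw [Complex.ofReal_inj.mp h]
    · rw [h, mul_zero, mul_zero]
  rw [hA.cfc_eq_mul, ← Matrix.mulVec_mulVec, ← Matrix.mulVec_mulVec, h2, Matrix.mulVec_smul,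
    Matrix.mulVec_mulVec, hUU', Matrix.one_mulVec]

/-- The functional calculus of a matrix that is diagonalized by an arbitrary unitary. -/
theorem cfc_unitary_conj_diagonal {V : Matrix n n ℂ} (hV : V * star V = 1) (s : n → ℝ)
    (g : ℝ → ℝ) :
    cfc g (V * Matrix.diagonal (fun j => ((s j : ℝ) : ℂ)) * star V) =
      V * Matrix.diagonal (fun j => ((g (s j) : ℝ) : ℂ)) * star V := by
  have hV' : star V * V = 1 := mul_eq_one_comm.mp hV
  set A := V * Matrix.diagonal (fun j => ((s j : ℝ) : ℂ)) * star V with hAdef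
  have hA : A.IsHermitian := by
    rw [Matrix.IsHermitian, hAdef, Matrix.star_eq_conjTranspose, Matrix.conjTranspose_mul,
      Matrix.conjTranspose_mul, Matrix.conjTranspose_conjTranspose,
      Matrix.diagonal_conjTranspose, Matrix.mul_assoc]
    congr 3
    ext j
    simp
  have hAV : A * V = V * Matrix.diagonal (fun j => ((s j : ℝ) : ℂ)) := by
    rw [hAdef, Matrix.mul_assoc, hV', Matrix.mul_one]
  have key : cfc g A * V = V * Matrix.diagonal (fun j => ((g (s j) : ℝ) : ℂ)) := by
    ext i j
    have h1 : A *ᵥ V.col j = ((s j : ℝ) : ℂ) • V.col j := by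
      ext i
      have := congrFun (congrFun hAV i) j
      rw [Matrix.mul_diagonal, mul_comm] at this
      exact this
    have := congrFun (cfc_mulVec_of_eigen hA g h1) i
    rw [Matrix.mul_diagonal, mul_comm]
    exact this
  rw [← key, Matrix.mul_assoc, hV, Matrix.mul_one]

/-- The weight of the vector `v` on the `j`-th eigenvector of `A`. -/
noncomputable def eigenWeight {A : Matrix n n ℂ} (hA : A.IsHermitian) (v : n → ℂ) (j : n) : ℝ :=
  Complex.normSq ((star (hA.eigenvectorUnitary : Matrix n n ℂ) *ᵥ v) j)

theorem eigenWeight_nonneg {A : Matrix n n ℂ} (hA : A.IsHermitian) (v : n → ℂ) (j : n) :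
    0 ≤ eigenWeight hA v j := Complex.normSq_nonneg _

/-- The weights form the spectral measure of `v`, so expectations of functions of `A` become finite
weighted sums. -/
theorem star_dotProduct_cfc_mulVec {A : Matrix n n ℂ} (hA : A.IsHermitian) (g : ℝ → ℝ)
    (v : n → ℂ) :
    star v ⬝ᵥ cfc g A *ᵥ v = ((∑ j, eigenWeight hA v j * g (hA.eigenvalues j) : ℝ) : ℂ) := by
  rw [hA.cfc_eq_mul, ← Matrix.mulVec_mulVec, ← Matrix.mulVec_mulVec, Matrix.dotProduct_mulVec,
    show star v ᵥ* (hA.eigenvectorUnitary : Matrix n n ℂ) =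
      star (star (hA.eigenvectorUnitary : Matrix n n ℂ) *ᵥ v) by
        rw [Matrix.star_mulVec, ← Matrix.star_eq_conjTranspose, star_star]]
  simp only [dotProduct, Matrix.mulVec_diagonal, Pi.star_apply, eigenWeight]
  push_cast
  refine Finset.sum_congr rfl fun j _ => ?_
  rw [Complex.normSq_eq_conj_mul_self]
  simp only [RCLike.star_def]
  ring

theorem sum_eigenWeight {A : Matrix n n ℂ} (hA : A.IsHermitian) {v : n → ℂ}
    (hv : star v ⬝ᵥ v = 1) : ∑ j, eigenWeight hA v j = 1 := by
  have := star_dotProduct_cfc_mulVec hA (fun _ => 1) v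
  rw [cfc_const_one ℝ A hA.isSelfAdjoint, Matrix.one_mulVec, hv] at this
  simp only [mul_one] at this
  exact_mod_cast this.symm

theorem sum_eigenWeight_mul {A : Matrix n n ℂ} (hA : A.IsHermitian) (v : n → ℂ) :
    ∑ j, eigenWeight hA v j * hA.eigenvalues j = (star v ⬝ᵥ A *ᵥ v).re := by
  have := star_dotProduct_cfc_mulVec hA id v
  rw [cfc_id ℝ A hA.isSelfAdjoint] at this
  rw [this, Complex.ofReal_re]
  rfl

theorem exists_eigenvector_of_eigenWeight_ne_zero {A : Matrix n n ℂ} (hA : A.IsHermitian)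
    {v : n → ℂ} {j : n} (h : eigenWeight hA v j ≠ 0) :
    ∃ u : n → ℂ, A *ᵥ u = (hA.eigenvalues j : ℂ) • u ∧ star u ⬝ᵥ v ≠ 0 := by
  refine ⟨hA.eigenvectorBasis j, ?_, fun h0 => h ?_⟩
  · exact hA.mulVec_eigenvectorBasis j
  · rw [eigenWeight, Complex.normSq_eq_zero, ← h0]
    simp only [Matrix.mulVec, dotProduct, Matrix.star_apply,
      Matrix.IsHermitian.eigenvectorUnitary_apply, Pi.star_apply]

/-- `v` is orthogonal to the kernel of `A`. -/
def InSupport (A : Matrix n n ℂ) (v : n → ℂ) : Prop :=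
  ∀ u : n → ℂ, A *ᵥ u = 0 → star u ⬝ᵥ v = 0

theorem InSupport.eigenvalue_ne_zero {A : Matrix n n ℂ} (hA : A.IsHermitian) {v : n → ℂ}
    (hv : InSupport A v) {j : n} (h : eigenWeight hA v j ≠ 0) : hA.eigenvalues j ≠ 0 := by
  intro h0
  obtain ⟨u, hu, huv⟩ := exists_eigenvector_of_eigenWeight_ne_zero hA h
  exact huv (hv u (by rw [hu, h0]; simp))

theorem expectation_pos {A : Matrix n n ℂ} (hA : A.PosSemidef) {v : n → ℂ}
    (hv1 : star v ⬝ᵥ v = 1) (hv : InSupport A v) : 0 < (star v ⬝ᵥ A *ᵥ v).re := by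
  rw [← sum_eigenWeight_mul hA.1]
  refine Finset.sum_pos' (fun j _ => mul_nonneg (eigenWeight_nonneg _ _ _)
    (hA.eigenvalues_nonneg j)) ?_
  by_contra! hcon
  have h0 : ∀ j, eigenWeight hA.1 v j = 0 := by
    intro j
    by_contra hj
    have h1 := lt_of_le_of_ne (eigenWeight_nonneg hA.1 v j) (Ne.symm hj)
    have h2 := lt_of_le_of_ne (hA.eigenvalues_nonneg j) (hv.eigenvalue_ne_zero hA.1 hj).symm
    exact absurd (hcon j (Finset.mem_univ j)) (not_le.mpr (mul_pos h1 h2))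
  have := sum_eigenWeight hA.1 hv1
  simp [h0] at this

/-- Jensen's inequality for the logarithm of a positive matrix. -/
theorem expectation_matrixLog_le {A : Matrix n n ℂ} (hA : A.PosSemidef) {v : n → ℂ}
    (hv1 : star v ⬝ᵥ v = 1) (hv : InSupport A v) :
    (star v ⬝ᵥ matrixLog A *ᵥ v).re ≤ Real.log (star v ⬝ᵥ A *ᵥ v).re := by
  set c := (star v ⬝ᵥ A *ᵥ v).re with hc
  have hcpos : 0 < c := expectation_pos hA hv1 hv
  rw [matrixLog, star_dotProduct_cfc_mulVec hA.1, Complex.ofReal_re]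
  -- The tangent line to the logarithm at the mean `c`: log (x / c) ≤ x / c - 1. Zero eigenvalues,
  -- where `Real.log` is a junk value, carry no weight.
  have hterm : ∀ j, eigenWeight hA.1 v j * Real.log (hA.1.eigenvalues j) ≤
      eigenWeight hA.1 v j * hA.1.eigenvalues j / c - eigenWeight hA.1 v j
        + eigenWeight hA.1 v j * Real.log c := by
    intro j
    by_cases hj : eigenWeight hA.1 v j = 0
    · simp [hj]
    have h2 := lt_of_le_of_ne (hA.eigenvalues_nonneg j) (hv.eigenvalue_ne_zero hA.1 hj).symm
    have h3 := Real.log_le_sub_one_of_pos (div_pos h2 hcpos)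
    rw [Real.log_div h2.ne' hcpos.ne'] at h3
    calc _ ≤ eigenWeight hA.1 v j * (hA.1.eigenvalues j / c - 1 + Real.log c) :=
          mul_le_mul_of_nonneg_left (by linarith) (eigenWeight_nonneg _ _ _)
      _ = _ := by ring
  refine (Finset.sum_le_sum fun j _ => hterm j).trans ?_
  rw [Finset.sum_add_distrib, Finset.sum_sub_distrib, ← Finset.sum_div, ← Finset.sum_mul,
    sum_eigenWeight_mul, sum_eigenWeight hA.1 hv1, ← hc, div_self hcpos.ne']
  simp

/-- If `P` commutes with `A` and `A'` is a multiple of `A` on the range of `P`, then the same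
relation holds between the functional calculi. -/
theorem cfc_mul_of_commute {A A' P : Matrix n n ℂ} (hA : A.IsHermitian) (hA' : A'.IsHermitian)
    (hPA : A * P = P * A) {c : ℝ} (h : A' * P = (c : ℂ) • (A * P)) (g : ℝ → ℝ) :
    cfc g A' * P = P * cfc (fun x => g (c * x)) A := by
  have hUU' : (hA.eigenvectorUnitary : Matrix n n ℂ) *
      star (hA.eigenvectorUnitary : Matrix n n ℂ) = 1 :=
    Unitary.coe_mul_star_self hA.eigenvectorUnitary
  -- It suffices to compare both sides on an eigenbasis of `A`: `P` sends an eigenvector of `A` to a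
  -- solution of the eigenvalue equation for `A'`, with eigenvalue scaled by `c`.
  have key : cfc g A' * P * (hA.eigenvectorUnitary : Matrix n n ℂ) =
      P * cfc (fun x => g (c * x)) A * (hA.eigenvectorUnitary : Matrix n n ℂ) := by
    ext i j
    set u : n → ℂ := (hA.eigenvectorUnitary : Matrix n n ℂ).col j with hu
    have h1 : A *ᵥ u = (hA.eigenvalues j : ℂ) • u := by
      have := hA.mulVec_eigenvectorBasis j
      rw [← Matrix.IsHermitian.eigenvectorUnitary_col_eq] at this
      exact this
    have h2 : A' *ᵥ (P *ᵥ u) = ((c * hA.eigenvalues j : ℝ) : ℂ) • (P *ᵥ u) := by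
      rw [Matrix.mulVec_mulVec, h, hPA, Matrix.smul_mulVec, ← Matrix.mulVec_mulVec, h1,
        Matrix.mulVec_smul, smul_smul]
      push_cast
      rfl
    have h3 := cfc_mulVec_of_eigen hA' g h2
    have h4 := cfc_mulVec_of_eigen hA (fun x => g (c * x)) h1
    have h5 : (cfc g A' * P) *ᵥ u = (P * cfc (fun x => g (c * x)) A) *ᵥ u := by
      rw [← Matrix.mulVec_mulVec, ← Matrix.mulVec_mulVec, h3, h4, Matrix.mulVec_smul]
    exact congrFun h5 i
  calc _ = cfc g A' * P * (hA.eigenvectorUnitary : Matrix n n ℂ) *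
        star (hA.eigenvectorUnitary : Matrix n n ℂ) := by
          rw [Matrix.mul_assoc _ _ (star _), hUU', Matrix.mul_one]
    _ = _ := by rw [key, Matrix.mul_assoc _ _ (star _), hUU', Matrix.mul_one]

end Spectral

/-! ### Orthogonal projectors as matrices -/

section Projection

variable {n : Type*} [Fintype n] [DecidableEq n] (W : Submodule ℂ (EuclideanSpace ℂ n))

theorem projMatrix_mulVec (v : n → ℂ) :
    projMatrix W *ᵥ v = (W.starProjection (WithLp.toLp 2 v)).ofLp := by
  rw [← Matrix.ofLp_toEuclideanCLM (projMatrix W) (WithLp.toLp 2 v), projMatrix,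
    StarAlgEquiv.apply_symm_apply]

theorem projMatrix_isHermitian : (projMatrix W).IsHermitian := by
  have h : IsSelfAdjoint W.starProjection := isSelfAdjoint_starProjection W
  have : star (projMatrix W) = projMatrix W := by
    rw [projMatrix]
    exact ((Matrix.toEuclideanCLM (n := n) (𝕜 := ℂ)).symm.map_star' _).symm.trans
      (congrArg _ h.star_eq)
  exact this

theorem projMatrix_mul_self : projMatrix W * projMatrix W = projMatrix W := by
  rw [projMatrix, ← map_mul]
  congr 1
  exact W.isIdempotentElem_starProjection

variable {W}

theorem projMatrix_mulVec_of_mem {v : EuclideanSpace ℂ n} (hv : v ∈ W) :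
    projMatrix W *ᵥ v.ofLp = v.ofLp := by
  rw [projMatrix_mulVec]
  exact congrArg _ (W.starProjection_eq_self_iff.mpr hv)

theorem toLp_projMatrix_mulVec_mem (v : n → ℂ) : WithLp.toLp 2 (projMatrix W *ᵥ v) ∈ W := by
  rw [projMatrix_mulVec]
  exact W.starProjection_apply_mem _

theorem projMatrix_mulVec_of_isOrtho {W' : Submodule ℂ (EuclideanSpace ℂ n)} (h : W ⟂ W')
    {v : EuclideanSpace ℂ n} (hv : v ∈ W') : projMatrix W *ᵥ v.ofLp = 0 := by
  rw [projMatrix_mulVec]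
  have : W.starProjection v = 0 := by
    rw [Submodule.starProjection_apply_eq_zero_iff]
    exact h.symm hv
  exact congrArg _ this

/-- A Hermitian matrix commutes with the projector onto an invariant subspace. -/
theorem commute_projMatrix {A : Matrix n n ℂ} (hA : A.IsHermitian)
    (hW : ∀ v ∈ W, Matrix.toEuclideanLin A v ∈ W) :
    A * projMatrix W = projMatrix W * A := by
  -- Invariance of the range gives PAP = AP; the adjoint of this identity is PAP = PA.
  have h1 : projMatrix W * A * projMatrix W = A * projMatrix W := by
    refine Matrix.ext_of_mulVec_single fun i => ?_
    rw [← Matrix.mulVec_mulVec, ← Matrix.mulVec_mulVec, ← Matrix.mulVec_mulVec]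
    exact projMatrix_mulVec_of_mem (hW _ (toLp_projMatrix_mulVec_mem _))
  have h2 := congrArg Matrix.conjTranspose h1
  rw [Matrix.conjTranspose_mul, Matrix.conjTranspose_mul, Matrix.conjTranspose_mul,
    (projMatrix_isHermitian W).eq, hA.eq, ← Matrix.mul_assoc, h1] at h2
  exact h2

end Projection

/-! ### Tensor powers: positivity, supports and additivity of the entropy -/

section Tensor

variable {d : ℕ} (ℓ : ℕ)

theorem tensorPow_conjTranspose (A : Matrix (Fin d) (Fin d) ℂ) :
    tensorPow ℓ Aᴴ = (tensorPow ℓ A)ᴴ := by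
  ext i j
  simp [tensorPow]

theorem tensorPow_star (A : Matrix (Fin d) (Fin d) ℂ) :
    tensorPow ℓ (star A) = star (tensorPow ℓ A) :=
  tensorPow_conjTranspose ℓ A

theorem tensorPow_smul (c : ℂ) (A : Matrix (Fin d) (Fin d) ℂ) :
    tensorPow ℓ (c • A) = c ^ ℓ • tensorPow ℓ A := by
  ext i j
  simp [tensorPow, Finset.prod_mul_distrib]

theorem tensorPow_diagonal (s : Fin d → ℂ) :
    tensorPow ℓ (Matrix.diagonal s) = Matrix.diagonal fun J => ∏ t, s (J t) := by
  ext i j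
  simp only [tensorPow, Matrix.of_apply, Matrix.diagonal_apply]
  by_cases h : i = j
  · simp [h]
  · obtain ⟨t, ht⟩ := Function.ne_iff.mp h
    rw [if_neg h]
    exact Finset.prod_eq_zero (Finset.mem_univ t) (if_neg ht)

theorem trace_tensorPow (A : Matrix (Fin d) (Fin d) ℂ) :
    (tensorPow ℓ A).trace = A.trace ^ ℓ := by
  simp only [Matrix.trace, tensorPow, Matrix.diag_apply, Matrix.of_apply]
  rw [← Fintype.piFinset_univ, ← Finset.prod_univ_sum (fun _ => Finset.univ)
    (fun _ a => A a a)]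
  simp

open scoped MatrixOrder in
theorem Matrix.PosSemidef.tensorPow {A : Matrix (Fin d) (Fin d) ℂ} (hA : A.PosSemidef) :
    (tensorPow ℓ A).PosSemidef := by
  obtain ⟨M, rfl⟩ := CStarAlgebra.nonneg_iff_eq_star_mul_self.mp hA.nonneg
  rw [tensorPow_mul, tensorPow_star]
  exact Matrix.posSemidef_conjTranspose_mul_self _

theorem IsState.tensorPow {A : Matrix (Fin d) (Fin d) ℂ} (hA : IsState A) :
    IsState (tensorPow ℓ A) :=
  ⟨hA.1.tensorPow ℓ, by rw [trace_tensorPow, hA.2, one_pow]⟩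

theorem tensorPow_mulVec (A : Matrix (Fin d) (Fin d) ℂ) (v : Fin d → ℂ) :
    tensorPow ℓ A *ᵥ (fun J => ∏ t, v (J t)) = fun J => ∏ t, (A *ᵥ v) (J t) := by
  ext J
  simp only [Matrix.mulVec, dotProduct, tensorPow, Matrix.of_apply, ← Finset.prod_mul_distrib]
  rw [← Fintype.piFinset_univ, ← Finset.prod_univ_sum (fun _ => Finset.univ)
    (fun t a => A (J t) a * v a)]

/-- Test the inclusion on product vectors v^{⊗ℓ} and read off diagonal coordinates; ℓ ≥ 1 makes the
product vanish with its factors. -/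
theorem SuppLE.of_tensorPow {ρ σ : Matrix (Fin d) (Fin d) ℂ} {ℓ : ℕ} (hℓ : 1 ≤ ℓ)
    (h : SuppLE (tensorPow ℓ ρ) (tensorPow ℓ σ)) : SuppLE ρ σ := by
  intro v hv
  have h1 := h (fun J => ∏ t, v (J t)) (by
    rw [tensorPow_mulVec, hv]
    ext J
    exact Finset.prod_eq_zero (Finset.mem_univ (⟨0, hℓ⟩ : Fin ℓ)) rfl)
  rw [tensorPow_mulVec] at h1
  ext a
  have := congrFun h1 fun _ => a
  simp only [Finset.prod_const, Pi.zero_apply] at this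
  exact pow_eq_zero_iff (by simp; omega) |>.mp this

theorem SuppLE.mul_eigenvectorUnitary {n : Type*} [Fintype n] [DecidableEq n]
    {ρ σ : Matrix n n ℂ} (hσ : σ.IsHermitian) (h : SuppLE ρ σ) {j : n}
    (hj : hσ.eigenvalues j = 0) (i : n) :
    (ρ * (hσ.eigenvectorUnitary : Matrix n n ℂ)) i j = 0 := by
  have h1 : σ *ᵥ (hσ.eigenvectorUnitary : Matrix n n ℂ).col j = 0 := by
    rw [hσ.eigenvectorUnitary_col_eq]
    refine (hσ.mulVec_eigenvectorBasis j).trans ?_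
    rw [hj, zero_smul]
  exact congrFun (h _ h1) i

/-- `X` is `ρ` times the pseudo-inverse of `σ`. Unlike the inclusion of kernels, this factorization
passes to tensor powers by multiplicativity. -/
theorem SuppLE.exists_eq_mul {n : Type*} [Fintype n] [DecidableEq n]
    {ρ σ : Matrix n n ℂ} (hσ : σ.IsHermitian) (h : SuppLE ρ σ) : ∃ X, ρ = X * σ := by
  set U : Matrix n n ℂ := (hσ.eigenvectorUnitary : Matrix n n ℂ) with hU
  have hUU : star U * U = 1 := Unitary.coe_star_mul_self hσ.eigenvectorUnitary
  have hUU' : U * star U = 1 := Unitary.coe_mul_star_self hσ.eigenvectorUnitary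
  refine ⟨ρ * U * Matrix.diagonal (fun j => ((hσ.eigenvalues j : ℝ) : ℂ)⁻¹) * star U, ?_⟩
  have h1 : ρ * U * Matrix.diagonal (fun j => ((hσ.eigenvalues j : ℝ) : ℂ)⁻¹) *
      Matrix.diagonal (fun j => ((hσ.eigenvalues j : ℝ) : ℂ)) = ρ * U := by
    rw [Matrix.mul_assoc, Matrix.diagonal_mul_diagonal]
    ext i j
    rw [Matrix.mul_diagonal]
    by_cases hj : hσ.eigenvalues j = 0
    · rw [h.mul_eigenvectorUnitary hσ hj, zero_mul]
    · rw [inv_mul_cancel₀ (Complex.ofReal_ne_zero.mpr hj), mul_one]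
  calc ρ = ρ * U * star U := by rw [Matrix.mul_assoc, hUU', Matrix.mul_one]
    _ = ρ * U * Matrix.diagonal (fun j => ((hσ.eigenvalues j : ℝ) : ℂ)⁻¹) *
        (star U * U) * Matrix.diagonal (fun j => ((hσ.eigenvalues j : ℝ) : ℂ)) * star U := by
      rw [hUU, Matrix.mul_one, h1]
    _ = ρ * U * Matrix.diagonal (fun j => ((hσ.eigenvalues j : ℝ) : ℂ)⁻¹) * star U *
        (U * Matrix.diagonal (fun j => ((hσ.eigenvalues j : ℝ) : ℂ)) * star U) := by
      simp only [Matrix.mul_assoc]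
    _ = _ := by rw [hU, ← hσ.eq_mul_diagonal_mul]

theorem SuppLE.tensorPow {ρ σ : Matrix (Fin d) (Fin d) ℂ} (hσ : σ.IsHermitian)
    (h : SuppLE ρ σ) : SuppLE (tensorPow ℓ ρ) (tensorPow ℓ σ) := by
  obtain ⟨X, rfl⟩ := h.exists_eq_mul hσ
  intro v hv
  rw [tensorPow_mul, ← Matrix.mulVec_mulVec, hv, Matrix.mulVec_zero]

/-- Linearity of expectation for ℓ independent copies: in the t-th summand all factors other than
the t-th sum to 1. -/
theorem sum_prod_mul_sum {ι R : Type*} [Fintype ι] [DecidableEq ι] [CommRing R] (p x : ι → R)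
    (hp : ∑ j, p j = 1) (ℓ : ℕ) :
    ∑ J : Fin ℓ → ι, (∏ t, p (J t)) * ∑ t, x (J t) = ℓ * ∑ j, p j * x j := by
  have key : ∀ t : Fin ℓ, ∑ J : Fin ℓ → ι, (∏ s, p (J s)) * x (J t) = ∑ j, p j * x j := by
    intro t
    have h1 : ∀ J : Fin ℓ → ι, (∏ s, p (J s)) * x (J t) =
        ∏ s, p (J s) * (if s = t then x (J s) else 1) := by
      intro J
      rw [Finset.prod_mul_distrib]
      simp
    simp_rw [h1]
    rw [← Fintype.piFinset_univ, ← Finset.prod_univ_sum (fun _ => Finset.univ)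
      (fun s a => p a * (if s = t then x a else 1)), Finset.prod_eq_single t]
    · simp
    · intro s _ hs
      simp [hs, hp]
    · simp
  simp_rw [Finset.mul_sum]
  rw [Finset.sum_comm]
  simp_rw [key, Finset.sum_const, Finset.card_univ, Fintype.card_fin, nsmul_eq_mul,
    Finset.mul_sum]

/-- In the product eigenbasis of σ^{⊗ℓ} the logarithm of a product eigenvalue is a sum, and the
diagonal of ρ^{⊗ℓ} is a product weight. -/
theorem trace_tensorPow_mul_matrixLog {ρ σ : Matrix (Fin d) (Fin d) ℂ} (hρ : ρ.trace = 1)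
    (hσ : σ.IsHermitian) (h : SuppLE ρ σ) :
    (tensorPow ℓ ρ * matrixLog (tensorPow ℓ σ)).trace = ℓ * (ρ * matrixLog σ).trace := by
  set U : Matrix (Fin d) (Fin d) ℂ := (hσ.eigenvectorUnitary : Matrix (Fin d) (Fin d) ℂ) with hU
  have hUU' : U * star U = 1 := Unitary.coe_mul_star_self hσ.eigenvectorUnitary
  have hTU : tensorPow ℓ U * star (tensorPow ℓ U) = 1 := by
    rw [← tensorPow_star, ← tensorPow_mul, hUU', tensorPow_one]
  have hS : tensorPow ℓ σ = tensorPow ℓ U * Matrix.diagonal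
      (fun J => ((∏ t, hσ.eigenvalues (J t) : ℝ) : ℂ)) * star (tensorPow ℓ U) := by
    conv_lhs => rw [hσ.eq_mul_diagonal_mul]
    rw [tensorPow_mul, tensorPow_mul, tensorPow_diagonal, tensorPow_star]
    push_cast
    rfl
  set p : Fin d → ℂ := fun j => (star U * ρ * U) j j with hp
  have hp0 : ∀ j, hσ.eigenvalues j = 0 → p j = 0 := by
    intro j hj
    simp only [hp]
    rw [Matrix.mul_assoc, Matrix.mul_apply]
    exact Finset.sum_eq_zero fun i _ => by rw [h.mul_eigenvectorUnitary hσ hj, mul_zero]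
  have hp1 : ∑ j, p j = 1 := by
    change (star U * ρ * U).trace = 1
    rw [Matrix.trace_mul_comm, ← Matrix.mul_assoc, hUU', Matrix.one_mul, hρ]
  have htr : ∀ {m : Type} [Fintype m] [DecidableEq m] (X V : Matrix m m ℂ) (s : m → ℂ),
      (X * (V * Matrix.diagonal s * star V)).trace = ∑ j, (star V * X * V) j j * s j := by
    intro m _ _ X V s
    rw [← Matrix.mul_assoc, Matrix.trace_mul_comm, ← Matrix.mul_assoc, ← Matrix.mul_assoc]
    simp [Matrix.trace, Matrix.mul_diagonal]
  rw [matrixLog, matrixLog, hS, cfc_unitary_conj_diagonal hTU, hσ.cfc_eq_mul, htr, htr,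
    ← tensorPow_star, ← tensorPow_mul, ← tensorPow_mul, ← hU]
  rw [← sum_prod_mul_sum p _ hp1]
  refine Finset.sum_congr rfl fun J _ => ?_
  change (∏ t, p (J t)) * _ = _
  -- With `Real.log 0 = 0` the logarithm of a product is not the sum when a factor vanishes; there
  -- the support condition kills the weight.
  by_cases h0 : ∃ t, hσ.eigenvalues (J t) = 0
  · obtain ⟨t, ht⟩ := h0
    rw [Finset.prod_eq_zero (Finset.mem_univ t) (hp0 _ ht), zero_mul, zero_mul]
  · push Not at h0
    rw [Real.log_prod fun t _ => h0 t]
    push_cast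
    rfl

/-- Additivity of the relative entropy on tensor powers. -/
theorem trace_tensorPow_mul_sub_matrixLog {ρ σ : Matrix (Fin d) (Fin d) ℂ} (hρ : IsState ρ)
    (hσ : σ.IsHermitian) (h : SuppLE ρ σ) :
    (tensorPow ℓ ρ * (matrixLog (tensorPow ℓ ρ) - matrixLog (tensorPow ℓ σ))).trace.re =
      ℓ * (ρ * (matrixLog ρ - matrixLog σ)).trace.re := by
  rw [Matrix.mul_sub, Matrix.trace_sub, trace_tensorPow_mul_matrixLog ℓ hρ.2 hσ h,
    trace_tensorPow_mul_matrixLog ℓ hρ.2 hρ.1.1 fun _ hv => hv, ← mul_sub, ← Matrix.trace_sub,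
    ← Matrix.mul_sub, ← Complex.ofReal_natCast, Complex.re_ofReal_mul]

end Tensor

/-! ### From `SU(d)`-invariance to invariance under Hermitian tensor powers -/

section Invariance

variable {d ℓ : ℕ}

/-- Divide by a d-th root of the determinant, which is a phase. -/
theorem exists_specialUnitary_smul {U : Matrix (Fin d) (Fin d) ℂ}
    (hU : U ∈ Matrix.unitaryGroup (Fin d) ℂ) :
    ∃ (c : ℂ) (g : Matrix.specialUnitaryGroup (Fin d) ℂ),
      U = c • (g : Matrix (Fin d) (Fin d) ℂ) := by
  rcases Nat.eq_zero_or_pos d with rfl | hd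
  · exact ⟨1, 1, Subsingleton.elim _ _⟩
  have hdet : ‖U.det‖ = 1 := CStarRing.norm_of_mem_unitary (Matrix.det_of_mem_unitary hU)
  obtain ⟨z, hz⟩ := IsAlgClosed.exists_pow_nat_eq U.det hd
  have hz1 : ‖z‖ = 1 := by
    rw [← hz, norm_pow] at hdet
    exact (pow_eq_one_iff_of_nonneg (norm_nonneg _) hd.ne').mp hdet
  have hz0 : z ≠ 0 := by
    rintro rfl
    simp at hz1
  refine ⟨z, ⟨z⁻¹ • U, Matrix.mem_specialUnitaryGroup_iff.mpr ⟨?_, ?_⟩⟩, ?_⟩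
  · rw [Matrix.mem_unitaryGroup_iff] at hU ⊢
    rw [star_smul, Matrix.smul_mul, Matrix.mul_smul, hU, smul_smul, Complex.star_def,
      Complex.mul_conj, Complex.normSq_eq_norm_sq, norm_inv, hz1]
    simp
  · rw [Matrix.det_smul, Fintype.card_fin, inv_pow, hz, inv_mul_cancel₀]
    rw [← hz]
    exact pow_ne_zero _ hz0
  · rw [smul_smul, mul_inv_cancel₀ hz0, one_smul]

theorem tensorPow_unitary_mem (B : Subrepresentation (tensorRep d ℓ))
    {U : Matrix (Fin d) (Fin d) ℂ} (hU : U ∈ Matrix.unitaryGroup (Fin d) ℂ)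
    {v : TensorSpace d ℓ} (hv : v ∈ B.toSubmodule) :
    Matrix.toEuclideanLin (tensorPow ℓ U) v ∈ B.toSubmodule := by
  obtain ⟨c, g, rfl⟩ := exists_specialUnitary_smul hU
  rw [tensorPow_smul, map_smul]
  exact B.toSubmodule.smul_mem _ (B.apply_mem_toSubmodule g hv)

theorem diagonal_mem_unitaryGroup {s : Fin d → ℂ} (hs : ∀ j, ‖s j‖ = 1) :
    Matrix.diagonal s ∈ Matrix.unitaryGroup (Fin d) ℂ := by
  rw [Matrix.mem_unitaryGroup_iff, Matrix.star_eq_conjTranspose, Matrix.diagonal_conjTranspose,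
    Matrix.diagonal_mul_diagonal, ← Matrix.diagonal_one]
  congr 1
  ext j
  simp [Complex.mul_conj, Complex.normSq_eq_norm_sq, hs]

/-- For w orthogonal to the block, ⟨w, diag(s)^{⊗ℓ} v⟩ is a polynomial in s. It vanishes on the
torus |s_j| = 1, where diag(s) is unitary, hence identically. -/
theorem tensorPow_diagonal_mem (B : Subrepresentation (tensorRep d ℓ)) (s : Fin d → ℂ)
    {v : TensorSpace d ℓ} (hv : v ∈ B.toSubmodule) :
    Matrix.toEuclideanLin (tensorPow ℓ (Matrix.diagonal s)) v ∈ B.toSubmodule := by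
  rw [← B.toSubmodule.orthogonal_orthogonal, Submodule.mem_orthogonal]
  intro w hw
  set p : MvPolynomial (Fin d) ℂ :=
    ∑ J : Fin ℓ → Fin d, MvPolynomial.C (v.ofLp J * star (w.ofLp J)) *
      ∏ t, MvPolynomial.X (J t) with hp
  have heval : ∀ s : Fin d → ℂ, MvPolynomial.eval s p =
      inner ℂ w (Matrix.toEuclideanLin (tensorPow ℓ (Matrix.diagonal s)) v) := by
    intro s
    rw [tensorPow_diagonal, hp]
    simp only [map_sum, map_mul, map_prod, MvPolynomial.eval_C, MvPolynomial.eval_X,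
      PiLp.inner_apply, Matrix.toLpLin_apply, Matrix.mulVec_diagonal, RCLike.inner_apply]
    refine Finset.sum_congr rfl fun J _ => ?_
    simp only [RCLike.star_def]
    ring
  have hinf : (Metric.sphere (0 : ℂ) 1).Infinite := by
    have : Infinite (Set.Ioc (-Real.pi) Real.pi) :=
      (Set.Ioc_infinite (by linarith [Real.pi_pos])).to_subtype
    have : Infinite Circle := Infinite.of_injective _ Circle.argEquiv.symm.injective
    have h : (Set.range fun z : Circle => (z : ℂ)).Infinite :=
      Set.infinite_range_of_injective Circle.coe_injective
    refine h.mono ?_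
    rintro _ ⟨z, rfl⟩
    simpa using Circle.norm_coe z
  have h0 : p = 0 := by
    refine MvPolynomial.funext_set (fun _ => Metric.sphere (0 : ℂ) 1) (fun _ => hinf) ?_
    intro x hx
    rw [heval, map_zero]
    refine (Submodule.mem_orthogonal' _ _).mp hw _ (tensorPow_unitary_mem B ?_ hv)
    exact diagonal_mem_unitaryGroup fun j => by simpa using hx j trivial
  rw [← heval, h0, map_zero]

/-- An `SU(d)`-invariant subspace is invariant under `A^{⊗ℓ}` for every Hermitian `A`. -/
theorem tensorPow_mem_of_isHermitian (B : Subrepresentation (tensorRep d ℓ))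
    {A : Matrix (Fin d) (Fin d) ℂ} (hA : A.IsHermitian)
    {v : TensorSpace d ℓ} (hv : v ∈ B.toSubmodule) :
    Matrix.toEuclideanLin (tensorPow ℓ A) v ∈ B.toSubmodule := by
  have h1 := tensorPow_unitary_mem B (star hA.eigenvectorUnitary).2 hv
  have h2 := tensorPow_diagonal_mem B (fun j => ((hA.eigenvalues j : ℝ) : ℂ)) h1
  have h3 := tensorPow_unitary_mem B hA.eigenvectorUnitary.2 h2
  rw [hA.eq_mul_diagonal_mul, tensorPow_mul, tensorPow_mul]
  convert h3 using 1
  simp [Matrix.toLpLin_apply, Matrix.mulVec_mulVec, Matrix.mul_assoc]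

end Invariance

/-! ### Pinching in an orthonormal basis, and normalized blocks -/

section Basis

variable {n κ : Type*} [Fintype n] [DecidableEq n] [Fintype κ]
  (f : OrthonormalBasis κ ℂ (EuclideanSpace ℂ n))

theorem Matrix.IsHermitian.star_dotProduct_mulVec {n : Type*} [Fintype n] {A : Matrix n n ℂ} (hA : A.IsHermitian)
    (u v : n → ℂ) : star u ⬝ᵥ A *ᵥ v = star (A *ᵥ u) ⬝ᵥ v := by
  rw [Matrix.star_mulVec, hA.eq, Matrix.dotProduct_mulVec]

theorem OrthonormalBasis.star_dotProduct [DecidableEq κ] (k l : κ) :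
    star (f k).ofLp ⬝ᵥ (f l).ofLp = if k = l then 1 else 0 := by
  rw [dotProduct_comm, ← EuclideanSpace.inner_eq_star_dotProduct]
  exact orthonormal_iff_ite.mp f.orthonormal k l

theorem OrthonormalBasis.star_dotProduct_self (k : κ) :
    star (f k).ofLp ⬝ᵥ (f k).ofLp = 1 := by
  classical
  rw [f.star_dotProduct, if_pos rfl]

theorem OrthonormalBasis.matrix_trace (X : Matrix n n ℂ) :
    X.trace = ∑ k, star (f k).ofLp ⬝ᵥ X *ᵥ (f k).ofLp := by
  have h := LinearMap.trace_eq_sum_inner (Matrix.toEuclideanLin X) f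
  rw [show LinearMap.trace ℂ _ (Matrix.toEuclideanLin X) = X.trace from by
    rw [Matrix.toEuclideanLin_eq_toLin_orthonormal, Matrix.trace_toLin_eq]] at h
  rw [h]
  refine Finset.sum_congr rfl fun k _ => ?_
  rw [EuclideanSpace.inner_eq_star_dotProduct, dotProduct_comm]
  rfl

theorem trace_mul_of_eigenbasis {A : Matrix n n ℂ} (hA : A.IsHermitian) {α : κ → ℝ}
    (h : ∀ k, A *ᵥ (f k).ofLp = (α k : ℂ) • (f k).ofLp) (X : Matrix n n ℂ) :
    (A * X).trace.re = ∑ k, α k * (star (f k).ofLp ⬝ᵥ X *ᵥ (f k).ofLp).re := by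
  rw [f.matrix_trace, Complex.re_sum]
  refine Finset.sum_congr rfl fun k _ => ?_
  rw [← Matrix.mulVec_mulVec, hA.star_dotProduct_mulVec, h, star_smul, smul_dotProduct,
    Complex.star_def, Complex.conj_ofReal, smul_eq_mul, Complex.re_ofReal_mul]

theorem ketbra_mulVec (v : EuclideanSpace ℂ n) (u : n → ℂ) :
    ketbra v *ᵥ u = (star v.ofLp ⬝ᵥ u) • v.ofLp := by
  rw [ketbra, Matrix.vecMulVec_mulVec]
  ext i
  simp [mul_comm]

theorem ketbra_mul_mul_ketbra (v : EuclideanSpace ℂ n) (A : Matrix n n ℂ) :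
    ketbra v * A * ketbra v = (star v.ofLp ⬝ᵥ A *ᵥ v.ofLp) • ketbra v := by
  refine Matrix.ext_of_mulVec_single fun i => ?_
  rw [← Matrix.mulVec_mulVec, ← Matrix.mulVec_mulVec, Matrix.smul_mulVec, ketbra_mulVec v (Pi.single i 1),
    Matrix.mulVec_smul, Matrix.mulVec_smul, ketbra_mulVec, smul_comm]

theorem ketbra_isHermitian (v : EuclideanSpace ℂ n) : (ketbra v).IsHermitian := by
  rw [Matrix.IsHermitian, ketbra, Matrix.conjTranspose_vecMulVec, star_star]

theorem pinching_isHermitian {A : Matrix n n ℂ} (hA : A.IsHermitian) :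
    (pinching f A).IsHermitian := by
  rw [Matrix.IsHermitian, pinching, Matrix.conjTranspose_sum]
  refine Finset.sum_congr rfl fun k _ => ?_
  rw [Matrix.conjTranspose_mul, Matrix.conjTranspose_mul, (ketbra_isHermitian _).eq, hA.eq,
    Matrix.mul_assoc]

theorem Matrix.IsHermitian.star_dotProduct_eq_ofReal {A : Matrix n n ℂ} (hA : A.IsHermitian)
    (v : n → ℂ) : star v ⬝ᵥ A *ᵥ v = ((star v ⬝ᵥ A *ᵥ v).re : ℂ) := by
  have := star_dotProduct_cfc_mulVec hA id v
  rw [cfc_id ℝ A hA.isSelfAdjoint] at this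
  rw [this, Complex.ofReal_re]

theorem pinching_mulVec_basis {A : Matrix n n ℂ} (hA : A.IsHermitian) (k : κ) :
    pinching f A *ᵥ (f k).ofLp =
      (((star (f k).ofLp ⬝ᵥ A *ᵥ (f k).ofLp).re : ℝ) : ℂ) • (f k).ofLp := by
  classical
  rw [← hA.star_dotProduct_eq_ofReal, pinching, Matrix.sum_mulVec, Finset.sum_eq_single k]
  · rw [ketbra_mul_mul_ketbra, Matrix.smul_mulVec, ketbra_mulVec, f.star_dotProduct_self, one_smul]
  · intro l _ hl
    rw [ketbra_mul_mul_ketbra, Matrix.smul_mulVec, ketbra_mulVec, f.star_dotProduct, if_neg hl,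
      zero_smul, smul_zero]
  · simp

/-- The difference of the classical and the quantum logarithm of `A` in the state `f k`. -/
noncomputable def logGap (A : Matrix n n ℂ) (k : κ) : ℝ :=
  Real.log (star (f k).ofLp ⬝ᵥ A *ᵥ (f k).ofLp).re -
    (star (f k).ofLp ⬝ᵥ matrixLog A *ᵥ (f k).ofLp).re

/-- Each f_k is an eigenvector of `pinching f C` with eigenvalue ⟨f_k, C f_k⟩, so the logarithm of
the pinched matrix contributes the first half of `logGap`. -/
theorem trace_mul_pinching_sub {A C : Matrix n n ℂ} (hA : A.IsHermitian) (hC : C.IsHermitian)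
    {α : κ → ℝ} (h : ∀ k, A *ᵥ (f k).ofLp = (α k : ℂ) • (f k).ofLp) :
    (A * (matrixLog (pinching f C) - matrixLog C)).trace.re = ∑ k, α k * logGap f C k := by
  rw [trace_mul_of_eigenbasis f hA h]
  refine Finset.sum_congr rfl fun k _ => ?_
  rw [logGap, Matrix.sub_mulVec, dotProduct_sub, Complex.sub_re, matrixLog,
    cfc_mulVec_of_eigen (pinching_isHermitian f hC) _ (pinching_mulVec_basis f hC k),
    dotProduct_smul, f.star_dotProduct_self, smul_eq_mul, mul_one, Complex.ofReal_re]

theorem blockState_isHermitian (W : Submodule ℂ (EuclideanSpace ℂ n)) {A : Matrix n n ℂ}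
    (hA : A.IsHermitian) : (blockState W A).IsHermitian := by
  rw [Matrix.IsHermitian, blockState, Matrix.conjTranspose_smul, Matrix.conjTranspose_mul,
    Matrix.conjTranspose_mul, (projMatrix_isHermitian W).eq, hA.eq, Complex.star_def,
    Complex.conj_ofReal, Matrix.mul_assoc]

theorem blockWeight_nonneg (W : Submodule ℂ (EuclideanSpace ℂ n)) {A : Matrix n n ℂ}
    (hA : A.PosSemidef) : 0 ≤ blockWeight W A := by
  have h := hA.mul_mul_conjTranspose_same (projMatrix W)
  rw [(projMatrix_isHermitian W).eq] at h
  exact (Complex.nonneg_iff.mp h.trace_nonneg).1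

theorem blockState_posSemidef (W : Submodule ℂ (EuclideanSpace ℂ n)) {A : Matrix n n ℂ}
    (hA : A.PosSemidef) : (blockState W A).PosSemidef := by
  have h := hA.mul_mul_conjTranspose_same (projMatrix W)
  rw [(projMatrix_isHermitian W).eq] at h
  exact h.smul (Complex.zero_le_real.mpr (inv_nonneg.mpr (blockWeight_nonneg W hA)))

theorem trace_blockState_re (W : Submodule ℂ (EuclideanSpace ℂ n)) (A : Matrix n n ℂ) :
    (blockState W A).trace.re = (blockWeight W A)⁻¹ * blockWeight W A := by
  rw [blockState, Matrix.trace_smul, smul_eq_mul, Complex.re_ofReal_mul]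
  rfl

theorem projMatrix_mul_mul_of_commute {W : Submodule ℂ (EuclideanSpace ℂ n)} {A : Matrix n n ℂ}
    (h : A * projMatrix W = projMatrix W * A) :
    projMatrix W * A * projMatrix W = A * projMatrix W := by
  rw [← h, Matrix.mul_assoc, projMatrix_mul_self]

theorem blockState_mulVec {W : Submodule ℂ (EuclideanSpace ℂ n)} {A : Matrix n n ℂ}
    (h : A * projMatrix W = projMatrix W * A) (v : n → ℂ) :
    blockState W A *ᵥ v =
      (((blockWeight W A)⁻¹ : ℝ) : ℂ) • (A *ᵥ (projMatrix W *ᵥ v)) := by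
  rw [blockState, projMatrix_mul_mul_of_commute h, Matrix.smul_mulVec, Matrix.mulVec_mulVec]

/-- A zero weight has to be excluded: `0⁻¹ = 0` would make the block of `S` zero. -/
theorem SuppLE.blockState {W : Submodule ℂ (EuclideanSpace ℂ n)} {R S : Matrix n n ℂ}
    (h : SuppLE R S) (hR : R * projMatrix W = projMatrix W * R)
    (hS : S * projMatrix W = projMatrix W * S) (hW : blockWeight W S ≠ 0) :
    SuppLE (blockState W R) (blockState W S) := by
  intro v hv
  rw [blockState_mulVec hS] at hv
  rw [blockState_mulVec hR, h _ ((smul_eq_zero.mp hv).resolve_left ?_), smul_zero]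
  exact Complex.ofReal_ne_zero.mpr (inv_ne_zero hW)

end Basis

/-- `f` is an eigenbasis of `R` with eigenvalues `r`, the vector `f k` lies in the block
`W (b k)`, the blocks are pairwise orthogonal, and `R` and `S` are states that commute with the
projectors onto the blocks. -/
structure IsAdaptedBasis {n ι κ : Type*} [Fintype n] [DecidableEq n] [Fintype κ]
    (W : ι → Submodule ℂ (EuclideanSpace ℂ n)) (f : OrthonormalBasis κ ℂ (EuclideanSpace ℂ n))
    (R S : Matrix n n ℂ) (r : κ → ℝ) (b : κ → ι) : Prop where
  isState_left : IsState R
  isState_right : IsState S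
  ortho : ∀ i j, i ≠ j → W i ⟂ W j
  commute_left : ∀ i, R * projMatrix (W i) = projMatrix (W i) * R
  commute_right : ∀ i, S * projMatrix (W i) = projMatrix (W i) * S
  eigen : ∀ k, R *ᵥ (f k).ofLp = (r k : ℂ) • (f k).ofLp
  mem : ∀ k, f k ∈ W (b k)

/-! ### Entropies in an adapted eigenbasis, block by block -/

namespace IsAdaptedBasis

variable {n ι κ : Type*} [Fintype n] [DecidableEq n] [DecidableEq ι] [Fintype κ]
  {W : ι → Submodule ℂ (EuclideanSpace ℂ n)} {f : OrthonormalBasis κ ℂ (EuclideanSpace ℂ n)}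
  {R S : Matrix n n ℂ} {r : κ → ℝ} {b : κ → ι}

theorem projMatrix_mulVec (h : IsAdaptedBasis W f R S r b) (i : ι) (k : κ) :
    projMatrix (W i) *ᵥ (f k).ofLp = if b k = i then (f k).ofLp else 0 := by
  split_ifs with hk
  · exact projMatrix_mulVec_of_mem (hk ▸ h.mem k)
  · exact projMatrix_mulVec_of_isOrtho (h.ortho i (b k) (Ne.symm hk)) (h.mem k)

theorem eigenvalue_eq (h : IsAdaptedBasis W f R S r b) (k : κ) :
    (star (f k).ofLp ⬝ᵥ R *ᵥ (f k).ofLp).re = r k := by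
  rw [h.eigen, dotProduct_smul, f.star_dotProduct_self, smul_eq_mul, mul_one, Complex.ofReal_re]

theorem eigenvalue_nonneg (h : IsAdaptedBasis W f R S r b) (k : κ) : 0 ≤ r k := by
  rw [← h.eigenvalue_eq]
  exact (Complex.nonneg_iff.mp (h.isState_left.1.dotProduct_mulVec_nonneg _)).1

theorem star_dotProduct_proj (h : IsAdaptedBasis W f R S r b) (A : Matrix n n ℂ) (i : ι)
    (k : κ) :
    star (f k).ofLp ⬝ᵥ (projMatrix (W i) * A * projMatrix (W i)) *ᵥ (f k).ofLp =
      if b k = i then star (f k).ofLp ⬝ᵥ A *ᵥ (f k).ofLp else 0 := by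
  rw [Matrix.mul_assoc, ← Matrix.mulVec_mulVec, (projMatrix_isHermitian _).star_dotProduct_mulVec,
    ← Matrix.mulVec_mulVec, h.projMatrix_mulVec]
  split_ifs <;> simp

theorem outcomeProb_eq (h : IsAdaptedBasis W f R S r b) (A : Matrix n n ℂ) (i : ι) (k : κ) :
    outcomeProb W f A (i, k) =
      if b k = i then (star (f k).ofLp ⬝ᵥ A *ᵥ (f k).ofLp).re else 0 := by
  have h1 : (ketbra (f k)).trace = 1 := by
    rw [ketbra, Matrix.trace_vecMulVec, dotProduct_comm, f.star_dotProduct_self]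
  rw [outcomeProb, Matrix.mul_assoc (ketbra (f k)), Matrix.mul_assoc (ketbra (f k)),
    ketbra_mul_mul_ketbra, h.star_dotProduct_proj, Matrix.trace_smul, h1, smul_eq_mul, mul_one]
  split_ifs <;> simp

theorem blockWeight_eq (h : IsAdaptedBasis W f R S r b) (A : Matrix n n ℂ) (i : ι) :
    blockWeight (W i) A =
      ∑ k, if b k = i then (star (f k).ofLp ⬝ᵥ A *ᵥ (f k).ofLp).re else 0 := by
  rw [blockWeight, f.matrix_trace, Complex.re_sum]
  refine Finset.sum_congr rfl fun k _ => ?_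
  rw [h.star_dotProduct_proj]
  split_ifs <;> simp

theorem blockWeight_left (h : IsAdaptedBasis W f R S r b) (i : ι) :
    blockWeight (W i) R = ∑ k, if b k = i then r k else 0 := by
  simp_rw [h.blockWeight_eq, h.eigenvalue_eq]

theorem sum_blockWeight_left [Fintype ι] (h : IsAdaptedBasis W f R S r b) :
    ∑ i, blockWeight (W i) R = 1 := by
  simp_rw [h.blockWeight_left]
  rw [Finset.sum_comm]
  simp only [Finset.sum_ite_eq, Finset.mem_univ, if_true]
  have := congrArg Complex.re h.isState_left.2
  rw [f.matrix_trace, Complex.re_sum, Complex.one_re] at this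
  simpa only [h.eigenvalue_eq] using this

theorem blockState_left_mulVec (h : IsAdaptedBasis W f R S r b) (i : ι) (k : κ) :
    blockState (W i) R *ᵥ (f k).ofLp =
      (((if b k = i then (blockWeight (W i) R)⁻¹ * r k else 0 : ℝ)) : ℂ) • (f k).ofLp := by
  rw [blockState_mulVec (h.commute_left i), h.projMatrix_mulVec]
  split_ifs
  · rw [h.eigen, smul_smul]
    push_cast
    rfl
  · simp

/-- An eigenvector of `R` with nonzero eigenvalue is orthogonal to ker R, which contains ker S. -/
theorem inSupport (h : IsAdaptedBasis W f R S r b) (hRS : SuppLE R S) {k : κ} (hk : r k ≠ 0) :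
    InSupport S (f k).ofLp := by
  intro u hu
  have h1 := h.isState_left.1.1.star_dotProduct_mulVec u (f k).ofLp
  rw [hRS u hu, h.eigen, dotProduct_smul, star_zero, zero_dotProduct, smul_eq_zero] at h1
  exact h1.resolve_left (Complex.ofReal_ne_zero.mpr hk)

theorem blockWeight_right_pos (h : IsAdaptedBasis W f R S r b) (hRS : SuppLE R S) {k : κ}
    (hk : r k ≠ 0) : 0 < blockWeight (W (b k)) S := by
  have h1 := expectation_pos h.isState_right.1 (f.star_dotProduct_self k) (h.inSupport hRS hk)
  refine lt_of_lt_of_le h1 ?_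
  rw [h.blockWeight_eq]
  refine le_trans (by rw [if_pos rfl]) (Finset.single_le_sum (f := fun l => if b l = b k then
    (star (f l).ofLp ⬝ᵥ S *ᵥ (f l).ofLp).re else 0) (fun l _ => ?_) (Finset.mem_univ k))
  dsimp only
  split_ifs
  · exact (Complex.nonneg_iff.mp (h.isState_right.1.dotProduct_mulVec_nonneg _)).1
  · exact le_rfl

theorem exists_of_blockWeight_ne_zero (h : IsAdaptedBasis W f R S r b) {i : ι}
    (hi : blockWeight (W i) R ≠ 0) : ∃ k, b k = i ∧ r k ≠ 0 := by
  rw [h.blockWeight_left] at hi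
  obtain ⟨k, -, hk⟩ := Finset.exists_ne_zero_of_sum_ne_zero hi
  by_cases hbk : b k = i
  · exact ⟨k, hbk, by simpa [hbk] using hk⟩
  · simp [hbk] at hk

/-- Normalizing a block changes both logarithms by the same constant. -/
theorem logGap_blockState (h : IsAdaptedBasis W f R S r b) (hRS : SuppLE R S) {k : κ}
    (hk : r k ≠ 0) : logGap f (blockState (W (b k)) S) k = logGap f S k := by
  set w := blockWeight (W (b k)) S with hw
  have hwpos : 0 < w := h.blockWeight_right_pos hRS hk
  have hSherm := h.isState_right.1.1
  have hsupp := h.inSupport hRS hk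
  have hP : projMatrix (W (b k)) *ᵥ (f k).ofLp = (f k).ofLp :=
    projMatrix_mulVec_of_mem (h.mem k)
  have hq := expectation_pos h.isState_right.1 (f.star_dotProduct_self k) hsupp
  have h1 : (star (f k).ofLp ⬝ᵥ blockState (W (b k)) S *ᵥ (f k).ofLp).re =
      w⁻¹ * (star (f k).ofLp ⬝ᵥ S *ᵥ (f k).ofLp).re := by
    rw [blockState_mulVec (h.commute_right _), hP, dotProduct_smul, smul_eq_mul,
      Complex.re_ofReal_mul]
  have h2 : blockState (W (b k)) S * projMatrix (W (b k)) =
      ((w⁻¹ : ℝ) : ℂ) • (S * projMatrix (W (b k))) := by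
    rw [blockState, projMatrix_mul_mul_of_commute (h.commute_right _), Matrix.smul_mul,
      Matrix.mul_assoc, projMatrix_mul_self]
  have h3 : star (f k).ofLp ⬝ᵥ matrixLog (blockState (W (b k)) S) *ᵥ (f k).ofLp =
      star (f k).ofLp ⬝ᵥ cfc (fun x => Real.log (w⁻¹ * x)) S *ᵥ (f k).ofLp := by
    have h4 := cfc_mul_of_commute hSherm (blockState_isHermitian (W (b k)) hSherm)
      (h.commute_right _) h2 Real.log
    have h5 := congrArg (fun M => star (f k).ofLp ⬝ᵥ M *ᵥ (f k).ofLp) h4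
    simp only [← Matrix.mulVec_mulVec, hP] at h5
    rw [matrixLog, h5, (projMatrix_isHermitian _).star_dotProduct_mulVec, hP]
  rw [logGap, logGap, h1, h3, matrixLog, star_dotProduct_cfc_mulVec hSherm,
    star_dotProduct_cfc_mulVec hSherm, Complex.ofReal_re, Complex.ofReal_re,
    Real.log_mul (inv_ne_zero hwpos.ne') hq.ne']
  -- The logarithm splits only at nonzero eigenvalues; the others have weight zero because f_k lies
  -- in the support of `S`.
  have h6 : ∀ j, eigenWeight hSherm (f k).ofLp j * Real.log (w⁻¹ * hSherm.eigenvalues j) =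
      eigenWeight hSherm (f k).ofLp j * Real.log w⁻¹ +
        eigenWeight hSherm (f k).ofLp j * Real.log (hSherm.eigenvalues j) := by
    intro j
    by_cases hj : eigenWeight hSherm (f k).ofLp j = 0
    · simp [hj]
    · rw [Real.log_mul (inv_ne_zero hwpos.ne') (hsupp.eigenvalue_ne_zero hSherm hj), mul_add]
  simp_rw [h6]
  rw [Finset.sum_add_distrib, ← Finset.sum_mul,
    sum_eigenWeight hSherm (f.star_dotProduct_self k)]
  ring

/-- Basis vectors outside block i are killed by ρ_i; those inside have eigenvalue r_k / a_i, and
their gap is unchanged by normalization. -/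
theorem pinchingGap_blockState (h : IsAdaptedBasis W f R S r b) (hRS : SuppLE R S) {i : ι}
    (hi : blockWeight (W i) R ≠ 0) :
    pinchingGap f (blockState (W i) R) (blockState (W i) S) =
      (((blockWeight (W i) R)⁻¹ * ∑ k, if b k = i then r k * logGap f S k else 0 : ℝ) :
        EReal) := by
  obtain ⟨l, rfl, hl⟩ := h.exists_of_blockWeight_ne_zero hi
  rw [pinchingGap, if_pos (hRS.blockState (h.commute_left _) (h.commute_right _)
    (h.blockWeight_right_pos hRS hl).ne'),
    trace_mul_pinching_sub f (blockState_isHermitian _ h.isState_left.1.1)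
    (blockState_isHermitian _ h.isState_right.1.1) (h.blockState_left_mulVec _),
    Finset.mul_sum]
  congr 1
  refine Finset.sum_congr rfl fun k _ => ?_
  split_ifs with hk
  · by_cases hr : r k = 0
    · simp [hr]
    · rw [← hk, h.logGap_blockState hRS hr, mul_assoc]
  · simp

theorem omega_eq_top (h : IsAdaptedBasis W f R S r b) (hRS : ¬ SuppLE R S) :
    omega W f R S = ⊤ := by
  simp only [SuppLE, not_forall] at hRS
  obtain ⟨v, hv, hRv⟩ := hRS
  -- The block containing such an f_k is the one whose term is infinite: `v` is still killed by the
  -- block of `S`, as `S` commutes with the projector, but not by the block of `R`.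
  obtain ⟨k, hk⟩ : ∃ k, star (f k).ofLp ⬝ᵥ R *ᵥ v ≠ 0 := by
    by_contra! hcon
    apply hRv
    have : WithLp.toLp 2 (R *ᵥ v) = 0 := by
      refine f.repr.map_eq_zero_iff.mp ?_
      ext k
      rw [f.repr_apply_apply, EuclideanSpace.inner_eq_star_dotProduct, dotProduct_comm]
      exact hcon k
    exact congrArg WithLp.ofLp this
  rw [h.isState_left.1.1.star_dotProduct_mulVec, h.eigen, star_smul, smul_dotProduct,
    smul_ne_zero_iff] at hk
  have hrk : r k ≠ 0 := by
    intro h0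
    simp [h0] at hk
  set P := projMatrix (W (b k)) with hP
  have hPk : P *ᵥ (f k).ofLp = (f k).ofLp := projMatrix_mulVec_of_mem (h.mem k)
  have hw : blockWeight (W (b k)) R ≠ 0 := by
    rw [h.blockWeight_left]
    refine ne_of_gt (lt_of_lt_of_le (lt_of_le_of_ne (h.eigenvalue_nonneg k) hrk.symm) ?_)
    refine le_trans (by rw [if_pos rfl]) (Finset.single_le_sum
      (f := fun l => if b l = b k then r l else 0) (fun l _ => ?_) (Finset.mem_univ k))
    split_ifs
    · exact h.eigenvalue_nonneg l
    · exact le_rfl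
  have hgap : pinchingGap f (blockState (W (b k)) R) (blockState (W (b k)) S) = ⊤ := by
    rw [pinchingGap, if_neg]
    intro hcon
    have h1 := hcon v (by
      rw [blockState_mulVec (h.commute_right _), Matrix.mulVec_mulVec, h.commute_right,
        ← Matrix.mulVec_mulVec, hv, Matrix.mulVec_zero, smul_zero])
    have h2 := congrArg (star (f k).ofLp ⬝ᵥ ·) h1
    simp only [(blockState_isHermitian _ h.isState_left.1.1).star_dotProduct_mulVec,
      h.blockState_left_mulVec, if_pos, dotProduct_zero, star_smul, smul_dotProduct,
      smul_eq_zero] at h2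
    rcases h2 with h2 | h2
    · rw [Complex.star_def, Complex.conj_ofReal, Complex.ofReal_eq_zero] at h2
      exact mul_ne_zero (inv_ne_zero hw) hrk h2
    · exact hk.2 h2
  rw [omega, eq_top_iff, ← hgap]
  exact le_iSup₂_of_le (b k) hw le_rfl

theorem trace_mul_sub_matrixLog (h : IsAdaptedBasis W f R S r b) :
    (R * (matrixLog R - matrixLog S)).trace.re = ∑ k, r k * (Real.log (r k) -
      (star (f k).ofLp ⬝ᵥ matrixLog S *ᵥ (f k).ofLp).re) := by
  rw [trace_mul_of_eigenbasis f h.isState_left.1.1 h.eigen]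
  refine Finset.sum_congr rfl fun k _ => ?_
  rw [Matrix.sub_mulVec, dotProduct_sub, Complex.sub_re, matrixLog,
    cfc_mulVec_of_eigen h.isState_left.1.1 _ (h.eigen k), dotProduct_smul,
    f.star_dotProduct_self, smul_eq_mul, mul_one, Complex.ofReal_re]

/-- Since f_k lies in block `b k`, only the outcomes (b k, k) can have nonzero probability, and the
double sum collapses to one over k. -/
theorem measuredRelEntropy_eq [Fintype ι] (h : IsAdaptedBasis W f R S r b) (hRS : SuppLE R S) :
    measuredRelEntropy W f R S = ((∑ k, r k * (Real.log (r k) -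
      Real.log (star (f k).ofLp ⬝ᵥ S *ᵥ (f k).ofLp).re) : ℝ) : EReal) := by
  rw [measuredRelEntropy, classicalRelEntropy, if_pos]
  · congr 1
    rw [Fintype.sum_prod_type, Finset.sum_comm]
    refine Finset.sum_congr rfl fun k _ => ?_
    rw [Finset.sum_eq_single (b k)]
    · rw [h.outcomeProb_eq, h.outcomeProb_eq, if_pos rfl, if_pos rfl, h.eigenvalue_eq]
      by_cases hr : r k = 0
      · simp [hr]
      · rw [Real.log_div hr (expectation_pos h.isState_right.1 (f.star_dotProduct_self k)
          (h.inSupport hRS hr)).ne']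
    · intro i _ hi
      rw [h.outcomeProb_eq, if_neg (Ne.symm hi), zero_mul]
    · simp
  · rintro ⟨i, k⟩ hq
    rw [h.outcomeProb_eq] at hq ⊢
    split_ifs at hq ⊢
    · rw [h.eigenvalue_eq]
      by_contra hr
      exact (expectation_pos h.isState_right.1 (f.star_dotProduct_self k)
          (h.inSupport hRS hr)).ne' hq
    · rfl

theorem sum_logGap_eq (h : IsAdaptedBasis W f R S r b) :
    (R * (matrixLog R - matrixLog S)).trace.re - ∑ k, r k * (Real.log (r k) -
      Real.log (star (f k).ofLp ⬝ᵥ S *ᵥ (f k).ofLp).re) = ∑ k, r k * logGap f S k := by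
  rw [h.trace_mul_sub_matrixLog, ← Finset.sum_sub_distrib]
  refine Finset.sum_congr rfl fun k _ => ?_
  rw [logGap]
  ring

theorem sum_logGap_nonneg (h : IsAdaptedBasis W f R S r b) (hRS : SuppLE R S) :
    0 ≤ ∑ k, r k * logGap f S k := by
  refine Finset.sum_nonneg fun k _ => ?_
  by_cases hr : r k = 0
  · simp [hr]
  · exact mul_nonneg (h.eigenvalue_nonneg k) (sub_nonneg.mpr (expectation_matrixLog_le
      h.isState_right.1 (f.star_dotProduct_self k) (h.inSupport hRS hr)))

/-- The left side is the average of the terms of ω with weights a_i, and an average is at most the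
supremum. -/
theorem sum_logGap_le_omega [Fintype ι] (h : IsAdaptedBasis W f R S r b) (hRS : SuppLE R S) :
    ((∑ k, r k * logGap f S k : ℝ) : EReal) ≤ omega W f R S := by
  have hle : ∀ i, blockWeight (W i) R ≠ 0 → (((blockWeight (W i) R)⁻¹ *
      ∑ k, if b k = i then r k * logGap f S k else 0 : ℝ) : EReal) ≤ omega W f R S := by
    intro i hi
    rw [← h.pinchingGap_blockState hRS hi]
    exact le_iSup₂_of_le i hi le_rfl
  generalize omega W f R S = w at hle ⊢
  induction w with
  | top => exact le_top
  | bot =>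
    have : ∃ i, blockWeight (W i) R ≠ 0 := by
      by_contra! hcon
      have := h.sum_blockWeight_left
      simp [hcon] at this
    obtain ⟨i, hi⟩ := this
    exact absurd (le_bot_iff.mp (hle i hi)) (EReal.coe_ne_bot _)
  | coe w =>
    simp only [EReal.coe_le_coe_iff] at hle ⊢
    have hterm : ∀ i, (∑ k, if b k = i then r k * logGap f S k else 0) ≤
        blockWeight (W i) R * w := by
      intro i
      -- A block of weight zero is outside the supremum, but all its r_k ≥ 0 vanish, so it
      -- contributes nothing.
      by_cases hi : blockWeight (W i) R = 0
      · have h0 := hi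
        rw [h.blockWeight_left, Finset.sum_eq_zero_iff_of_nonneg] at h0
        · rw [hi, zero_mul]
          refine (Finset.sum_eq_zero fun k hk => ?_).le
          have := h0 k hk
          split_ifs at this ⊢
          · rw [this, zero_mul]
          · rfl
        · intro k _
          split_ifs
          · exact h.eigenvalue_nonneg k
          · exact le_rfl
      · have hpos := lt_of_le_of_ne (blockWeight_nonneg (W i) h.isState_left.1) (Ne.symm hi)
        exact (inv_mul_le_iff₀ hpos).mp (hle i hi)
    calc ∑ k, r k * logGap f S k
        = ∑ i, ∑ k, if b k = i then r k * logGap f S k else 0 := by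
          rw [Finset.sum_comm]
          simp
      _ ≤ ∑ i, blockWeight (W i) R * w := Finset.sum_le_sum fun i _ => hterm i
      _ = w := by rw [← Finset.sum_mul, h.sum_blockWeight_left, one_mul]

theorem pinchingGap_le_negLog (h : IsAdaptedBasis W f R S r b) {i : ι}
    (hi : blockWeight (W i) R ≠ 0) :
    pinchingGap f (blockState (W i) R) (blockState (W i) S) ≤
      negLog (minEigenvalueOn (W i) (blockState (W i) S)) := by
  set T := blockState (W i) S with hT
  have hTpos : T.PosSemidef := blockState_posSemidef _ h.isState_right.1
  set P := projMatrix (W i) with hP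
  have hTP : T * P = P * T := by
    rw [hT, blockState, Matrix.smul_mul, Matrix.mul_smul, Matrix.mul_assoc,
      projMatrix_mul_self, ← Matrix.mul_assoc P, ← Matrix.mul_assoc P, projMatrix_mul_self]
  set E : Set ℝ := {μ : ℝ | ∃ v ∈ W i, v ≠ 0 ∧ Matrix.toEuclideanLin T v = (μ : ℂ) • v} with hE
  have hEnonneg : ∀ μ ∈ E, 0 ≤ μ := by
    rintro μ ⟨v, -, hv0, hv⟩
    have h1 : T *ᵥ v.ofLp = (μ : ℂ) • v.ofLp := congrArg WithLp.ofLp hv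
    have h2 := hTpos.dotProduct_mulVec_nonneg v.ofLp
    rw [h1, dotProduct_smul, smul_eq_mul, Complex.nonneg_iff, Complex.re_ofReal_mul] at h2
    have h3 : 0 < star v.ofLp ⬝ᵥ v.ofLp :=
      Matrix.dotProduct_star_self_pos_iff.mpr fun h0 => hv0 (by ext j; exact congrFun h0 j)
    exact nonneg_of_mul_nonneg_left h2.1 (Complex.pos_iff.mp h3).1
  set lam := minEigenvalueOn (W i) T with hlam
  have hlam0 : 0 ≤ lam := Real.sInf_nonneg hEnonneg
  -- If the least eigenvalue is 0 (also the value of `sInf ∅`), the right side is +∞.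
  rcases hlam0.eq_or_lt with h0 | hpos
  · rw [← h0, negLog, ENNReal.ofReal_zero, ENNReal.log_zero, EReal.neg_bot]
    exact le_top
  have hmin : ∀ (u : n → ℂ) (μ : ℝ), T *ᵥ u = (μ : ℂ) • u → P *ᵥ u ≠ 0 → lam ≤ μ := by
    intro u μ hu hPu
    refine csInf_le ⟨0, hEnonneg⟩ ⟨WithLp.toLp 2 (P *ᵥ u), toLp_projMatrix_mulVec_mem u,
      fun h0 => hPu (congrArg WithLp.ofLp h0), ?_⟩
    have : T *ᵥ (P *ᵥ u) = (μ : ℂ) • (P *ᵥ u) := by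
      rw [Matrix.mulVec_mulVec, hTP, ← Matrix.mulVec_mulVec, hu, Matrix.mulVec_smul]
    exact congrArg (WithLp.toLp 2) this
  -- A vector of ker T with nonzero component in the block would give T the eigenvalue 0 there,
  -- below `lam`.
  have hsupp : SuppLE (blockState (W i) R) T := by
    intro v hv
    by_cases hPv : P *ᵥ v = 0
    · rw [blockState_mulVec (h.commute_left i), hPv, Matrix.mulVec_zero, smul_zero]
    · exact absurd (hmin v 0 (by simpa using hv) hPv) (not_le.mpr hpos)
  have hgap : ∀ k, b k = i → logGap f T k ≤ -Real.log lam := by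
    intro k hk
    have hPk : P *ᵥ (f k).ofLp = (f k).ofLp := projMatrix_mulVec_of_mem (hk ▸ h.mem k)
    have hnn : ∀ l, 0 ≤ (star (f l).ofLp ⬝ᵥ T *ᵥ (f l).ofLp).re := fun l =>
      (Complex.nonneg_iff.mp (hTpos.dotProduct_mulVec_nonneg _)).1
    have h1 : (star (f k).ofLp ⬝ᵥ T *ᵥ (f k).ofLp).re ≤ 1 := by
      calc _ ≤ ∑ l, (star (f l).ofLp ⬝ᵥ T *ᵥ (f l).ofLp).re :=
            Finset.single_le_sum (f := fun l => (star (f l).ofLp ⬝ᵥ T *ᵥ (f l).ofLp).re)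
              (fun l _ => hnn l) (Finset.mem_univ k)
        _ = T.trace.re := by rw [f.matrix_trace, Complex.re_sum]
        _ ≤ 1 := by
          rw [hT, trace_blockState_re]
          exact inv_mul_le_one
    have h2 : Real.log lam ≤ (star (f k).ofLp ⬝ᵥ matrixLog T *ᵥ (f k).ofLp).re := by
      rw [matrixLog, star_dotProduct_cfc_mulVec hTpos.1, Complex.ofReal_re]
      calc Real.log lam = ∑ j, eigenWeight hTpos.1 (f k).ofLp j * Real.log lam := by
            rw [← Finset.sum_mul, sum_eigenWeight hTpos.1 (f.star_dotProduct_self k), one_mul]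
        _ ≤ _ := by
          refine Finset.sum_le_sum fun j _ => ?_
          by_cases hj : eigenWeight hTpos.1 (f k).ofLp j = 0
          · simp [hj]
          obtain ⟨u, hu, huk⟩ := exists_eigenvector_of_eigenWeight_ne_zero hTpos.1 hj
          -- An eigenvector of `T` overlapping f_k has nonzero projection to the block, so its
          -- eigenvalue occurs on the block and is at least `lam`.
          refine mul_le_mul_of_nonneg_left (Real.log_le_log hpos (hmin u _ hu fun h0 => huk ?_))
            (eigenWeight_nonneg _ _ _)
          rw [← hPk, (projMatrix_isHermitian _).star_dotProduct_mulVec, ← hP, h0, star_zero,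
            zero_dotProduct]
    have h3 := Real.log_nonpos (hnn k) h1
    rw [logGap]
    linarith
  rw [negLog, ENNReal.log_ofReal_of_pos hpos, pinchingGap, if_pos hsupp,
    trace_mul_pinching_sub f (blockState_isHermitian _ h.isState_left.1.1) hTpos.1
      (h.blockState_left_mulVec _), ← EReal.coe_neg, EReal.coe_le_coe_iff]
  calc _ ≤ ∑ k, (if b k = i then (blockWeight (W i) R)⁻¹ * r k else 0) * -Real.log lam := by
        refine Finset.sum_le_sum fun k _ => ?_
        split_ifs with hk
        · exact mul_le_mul_of_nonneg_left (hgap k hk) (mul_nonneg (inv_nonneg.mpr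
            (blockWeight_nonneg _ h.isState_left.1)) (h.eigenvalue_nonneg k))
        · simp
    _ = (blockWeight (W i) R)⁻¹ * blockWeight (W i) R * -Real.log lam := by
        rw [← Finset.sum_mul, h.blockWeight_left, Finset.mul_sum]
        simp only [mul_ite, mul_zero]
    _ = _ := by rw [inv_mul_cancel₀ hi, one_mul]

end IsAdaptedBasis

/-! ### Assembly for tensor powers -/

theorem exists_isAdaptedBasis {d ℓ : ℕ} {ρ σ : Matrix (Fin d) (Fin d) ℂ} (hρ : IsState ρ)
    (hσ : IsState σ) {ι κ : Type*} [Fintype κ] {B : ι → Subrepresentation (tensorRep d ℓ)}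
    (hB : IsOrthogonalDecomposition B) {f : OrthonormalBasis κ ℂ (TensorSpace d ℓ)}
    (hf : IsAdaptedEigenbasis B ρ f) :
    ∃ (r : κ → ℝ) (b : κ → ι),
      IsAdaptedBasis (blocks B) f (tensorPow ℓ ρ) (tensorPow ℓ σ) r b := by
  have hR := hρ.tensorPow ℓ
  choose c hc using hf.1
  choose b hb using hf.2
  refine ⟨fun k => (c k).re, b, hR, hσ.tensorPow ℓ, hB.1, fun i => ?_, fun i => ?_,
    fun k => ?_, hb⟩
  · exact commute_projMatrix hR.1.1 fun v hv => tensorPow_mem_of_isHermitian (B i) hρ.1.1 hv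
  · exact commute_projMatrix (hσ.tensorPow ℓ).1.1 fun v hv =>
      tensorPow_mem_of_isHermitian (B i) hσ.1.1 hv
  · have h1 : tensorPow ℓ ρ *ᵥ (f k).ofLp = c k • (f k).ofLp := congrArg WithLp.ofLp (hc k)
    -- The eigenvalue equals ⟨f_k, R f_k⟩, which is real.
    have h2 := hR.1.1.star_dotProduct_eq_ofReal (f k).ofLp
    rw [h1, dotProduct_smul, f.star_dotProduct_self, smul_eq_mul, mul_one] at h2
    rw [h1, ← h2]

/-- Only `W` may be infinite: replacing it by the real `w` leaves an identity of real numbers. -/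
theorem EReal.sub_div_le_div {a m w : ℝ} {W : EReal} {ℓ : ℕ} (hℓ : 1 ≤ ℓ) (hw : ℓ * a - m = w)
    (hW : (w : EReal) ≤ W) : (a : EReal) - W / (ℓ : EReal) ≤ (m : EReal) / (ℓ : EReal) := by
  have hpos : (0 : ℝ) < ℓ := by exact_mod_cast hℓ
  have hcast : (ℓ : EReal) = ((ℓ : ℝ) : EReal) := rfl
  have h1 : ((w / ℓ : ℝ) : EReal) ≤ W / (ℓ : EReal) := by
    rw [EReal.coe_div, ← hcast]
    exact EReal.div_le_div_right_of_nonneg (by exact_mod_cast ℓ.zero_le) hW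
  calc (a : EReal) - W / (ℓ : EReal) ≤ (a : EReal) - ((w / ℓ : ℝ) : EReal) :=
        EReal.sub_le_sub le_rfl h1
    _ = ((a - w / ℓ : ℝ) : EReal) := (EReal.coe_sub _ _).symm
    _ = ((m / ℓ : ℝ) : EReal) := by
      rw [← hw]
      congr 1
      field_simp
      ring
    _ = _ := by rw [EReal.coe_div, ← hcast]

theorem theorem2 {d ℓ : ℕ} (hℓ : 1 ≤ ℓ)
    (ρ σ : Matrix (Fin d) (Fin d) ℂ) (hρ : IsState ρ) (hσ : IsState σ)
    {ι κ : Type*} [Fintype ι] [Fintype κ]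
    (B : ι → Subrepresentation (tensorRep d ℓ))
    (hB : IsIrrepDecomposition B ∨ IsIsotypicDecomposition B)
    (f : OrthonormalBasis κ ℂ (TensorSpace d ℓ)) (hf : IsAdaptedEigenbasis B ρ f) :
    relEntropy ρ σ - omega (blocks B) f (tensorPow ℓ ρ) (tensorPow ℓ σ) / (ℓ : EReal) ≤
        measuredRelEntropy (blocks B) f (tensorPow ℓ ρ) (tensorPow ℓ σ) / (ℓ : EReal) ∧
      measuredRelEntropy (blocks B) f (tensorPow ℓ ρ) (tensorPow ℓ σ) / (ℓ : EReal) ≤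
        relEntropy ρ σ ∧
      omega (blocks B) f (tensorPow ℓ ρ) (tensorPow ℓ σ) ≤
        ⨆ (i : ι) (_ : blockWeight (blocks B i) (tensorPow ℓ ρ) ≠ 0),
          negLog (minEigenvalueOn (blocks B i) (blockState (blocks B i) (tensorPow ℓ σ))) := by
  classical
  obtain ⟨r, b, h⟩ := exists_isAdaptedBasis (ℓ := ℓ) hρ hσ (hB.elim And.left And.left) hf
  have hpos : (0 : ℝ) < ℓ := by exact_mod_cast hℓ
  refine ⟨?_, ?_, iSup₂_mono fun i hi => h.pinchingGap_le_negLog hi⟩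
  · by_cases hs : SuppLE ρ σ
    · have hRS := hs.tensorPow ℓ hσ.1.1
      rw [h.measuredRelEntropy_eq hRS, relEntropy, if_pos hs]
      refine EReal.sub_div_le_div hℓ ?_ (h.sum_logGap_le_omega hRS)
      rw [← h.sum_logGap_eq, trace_tensorPow_mul_sub_matrixLog ℓ hρ hσ.1.1 hs]
    -- Here the left side is ⊤ - ⊤, which is ⊥ in `EReal`.
    · rw [h.omega_eq_top fun hRS => hs (hRS.of_tensorPow hℓ),
        EReal.top_div_of_pos_ne_top (by exact_mod_cast hℓ) (EReal.natCast_ne_top ℓ),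
        sub_eq_add_neg, EReal.neg_top, EReal.add_bot]
      exact bot_le
  · by_cases hs : SuppLE ρ σ
    · have hRS := hs.tensorPow ℓ hσ.1.1
      rw [h.measuredRelEntropy_eq hRS, relEntropy, if_pos hs,
        show (ℓ : EReal) = ((ℓ : ℝ) : EReal) from rfl, ← EReal.coe_div, EReal.coe_le_coe_iff,
        div_le_iff₀' hpos, ← trace_tensorPow_mul_sub_matrixLog ℓ hρ hσ.1.1 hs, ← sub_nonneg,
        h.sum_logGap_eq]
      exact h.sum_logGap_nonneg hRS
    · rw [relEntropy, if_neg hs]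
      exact le_top
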